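/- Fix $d$ and call a finite non-empty tuple $X=(x_1,\dots,x_n)$ of vectors (tokens) of $\mathbb{R}^d$ a sequence of length $n$. Two sequences are regarded as equal when they have the same set of tokens, i.e. when their Hausdorff distance (for the Euclidean norm) is $0$. A feed-forward layer of width $d'$ has parameters $\eta\in\mathbb{R}$, $W\in\mathbb{R}^{d\times d'}$, $U\in\mathbb{R}^{d'\times d}$, $b\in\mathbb{R}^{d'}$ and replaces every token $x$ by $\eta x+W\sigma(Ux+b)$, where $\sigma(t)=\max(0,t)$ acts entrywise. A softmax self-attention layer with temperature $\tau>0$ has parameters $\rho\in\mathbb{R}$, $V,A\in\mathbb{R}^{d\times d}$ and replaces the $i$-th token $x_i$ of $X=(x_1,\dots,x_n)$ by $$\rho x_i+V\sum_{\ell=1}^n \frac{\exp\left(\frac1\tau\langle Ax_i,x_\ell\rangle\right)}{\sum_{k=1}^n\exp\left(\frac1\tau\langle Ax_i,x_k\rangle\right)}\,x_\ell .$$ A softmax transformer $\mathrm{T}^\tau$ of width $d'$ with $L$ blocks is a composition of $L$ blocks, each of which is a feed-forward layer of width $d'$ followed by a softmax self-attention layer with temperature $\tau$. Its number of parameters $P$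 is the total number of real numbers describing its layers, where each of the matrices $V,A$ is described by $1$ number if it is given as $cI_d$ with $c\in\mathbb{R}$, by $d$ numbers if it is given as $vv^\top$ with $v\in\mathbb{R}^d$, and by its $d^2$ entries otherwise. **Theorem (Exact interpolation with softmax transformers).** There is an absolute constant $C$ such that the following holds. Let $N\in\mathbb{N}$ and $d\ge 2$, and let $X^1,\dots,X^N$ and $Y^1,\dots,Y^N$ be sequences in $\mathbb{R}^d$ of lengths $n^1,\dots,n^N$ and $m^1,\dots,m^N$ with $m^j\le n^j$ for all $j$, such that (i) $X^1,\dots,X^N$ are pairwise distinct as sets of tokens and (ii) the tokens within each $X^j$ and within each $Y^j$ are pairwise distinct. Then there exists $\tau^\star>0$ such that for all $0<\tau<\tau^\star$ there exists a softmax transformer $\mathrm{T}^\tau$ with temperature $\tau$, of width $d'\le 4$, with exactly $$L=2\sum_{j=1}^N m^j+3N\ \text{blocks}\qquad\text{and}\qquad P\le C\,d\sum_{j=1}^N m^j\ \text{parameters},$$ such that $\mathrm{T}^\tau(X^j)=Y^j$ for all $j=1,\dots,N$, in the sense of equality of the sets of tokens. -/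

import Mathlib

open scoped Matrix

noncomputable section

/-- A token is a vector of `ℝ^d` with the Euclidean norm. -/
abbrev Token (d : ℕ) : Type := EuclideanSpace ℝ (Fin d)

/-- A finite, non-empty sequence of tokens. -/
structure TokenSeq (d : ℕ) where
  len : ℕ
  len_pos : 0 < len
  tok : Fin len → Token d

/-- The Hausdorff distance between two sequences, viewed as (finite, non-empty) sets of tokens. -/
def TokenSeq.hausdorffDist {d : ℕ} (X Y : TokenSeq d) : ℝ :=
  Metric.hausdorffDist (Set.range X.tok) (Set.range Y.tok)

/-- Equality of sequences in the set sense: their Hausdorff distance vanishes. -/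
def TokenSeq.SameSet {d : ℕ} (X Y : TokenSeq d) : Prop :=
  X.hausdorffDist Y = 0

/-- The tokens of the sequence are pairwise distinct. -/
def TokenSeq.PairwiseDistinct {d : ℕ} (X : TokenSeq d) : Prop :=
  Function.Injective X.tok

/-- A parametrized `d × d` matrix: a multiple `c I` of the identity, a rank-one matrix `v vᵀ`,
or an arbitrary matrix given by all its entries. -/
inductive AttentionMatrix (d : ℕ) where
  | scalar (c : ℝ) : AttentionMatrix d
  | rankOne (v : Fin d → ℝ) : AttentionMatrix d
  | dense (M : Matrix (Fin d) (Fin d) ℝ) : AttentionMatrix d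

/-- The matrix described by the parameters. -/
def AttentionMatrix.toMatrix {d : ℕ} : AttentionMatrix d → Matrix (Fin d) (Fin d) ℝ
  | .scalar c => c • (1 : Matrix (Fin d) (Fin d) ℝ)
  | .rankOne v => Matrix.vecMulVec v v
  | .dense M => M

/-- The number of real parameters that describe the matrix. -/
def AttentionMatrix.numParams {d : ℕ} : AttentionMatrix d → ℕ
  | .scalar _ => 1
  | .rankOne _ => d
  | .dense _ => d * d

/-- Multiplication of a token by a matrix. -/
def matToken {d : ℕ} (M : Matrix (Fin d) (Fin d) ℝ) (x : Token d) : Token d :=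
  WithLp.toLp 2 (M *ᵥ x.ofLp)

/-- Parameters of a feed-forward layer of width `w` on `ℝ^d`. -/
structure FeedForward (d w : ℕ) where
  η : ℝ
  W : Matrix (Fin d) (Fin w) ℝ
  U : Matrix (Fin w) (Fin d) ℝ
  b : Fin w → ℝ

/-- The action `x ↦ η x + W σ(U x + b)` on one token, with `σ` the ReLU applied entrywise. -/
def FeedForward.onToken {d w : ℕ} (F : FeedForward d w) (x : Token d) : Token d :=
  F.η • x + WithLp.toLp 2 (F.W *ᵥ fun i => max 0 ((F.U *ᵥ x.ofLp) i + F.b i))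

/-- The feed-forward layer acts on every token separately. -/
def FeedForward.apply {d w : ℕ} (F : FeedForward d w) (X : TokenSeq d) : TokenSeq d where
  len := X.len
  len_pos := X.len_pos
  tok := fun i => F.onToken (X.tok i)

/-- All entries of `η`, `W`, `U`, `b` are counted. -/
def FeedForward.numParams {d w : ℕ} (_F : FeedForward d w) : ℕ :=
  1 + d * w + w * d + w

/-- The softmax weight of token `l` seen from token `i`, at temperature `τ`. -/
def softmaxWeight {d : ℕ} (τ : ℝ) (A : Matrix (Fin d) (Fin d) ℝ) (X : TokenSeq d)
    (i l : Fin X.len) : ℝ :=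
  Real.exp (1 / τ * inner ℝ (matToken A (X.tok i)) (X.tok l)) /
    ∑ k : Fin X.len, Real.exp (1 / τ * inner ℝ (matToken A (X.tok i)) (X.tok k))

/-- Parameters of a single-head self-attention layer on `ℝ^d`. -/
structure SelfAttention (d : ℕ) where
  ρ : ℝ
  V : AttentionMatrix d
  A : AttentionMatrix d

/-- The softmax self-attention layer at temperature `τ`:
`x_i ↦ ρ x_i + V ∑ l, π_{il} x_l`. -/
def SelfAttention.apply {d : ℕ} (S : SelfAttention d) (τ : ℝ) (X : TokenSeq d) : TokenSeq d where
  len := X.len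
  len_pos := X.len_pos
  tok := fun i => S.ρ • X.tok i +
    matToken S.V.toMatrix (∑ l : Fin X.len, softmaxWeight τ S.A.toMatrix X i l • X.tok l)

/-- The number of parameters `ρ`, `V`, `A` of a self-attention layer. -/
def SelfAttention.numParams {d : ℕ} (S : SelfAttention d) : ℕ :=
  1 + S.V.numParams + S.A.numParams

/-- A transformer block: a feed-forward layer of width `w` followed by a self-attention layer. -/
structure TransformerBlock (d w : ℕ) where
  ff : FeedForward d w
  sa : SelfAttention d

/-- The action of a block, with softmax attention at temperature `τ`. -/
def TransformerBlock.apply {d w : ℕ} (B : TransformerBlock d w) (τ : ℝ) (X : TokenSeq d) :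
    TokenSeq d :=
  B.sa.apply τ (B.ff.apply X)

/-- The number of parameters of a block. -/
def TransformerBlock.numParams {d w : ℕ} (B : TransformerBlock d w) : ℕ :=
  B.ff.numParams + B.sa.numParams

/-- A transformer on `ℝ^d` of constant width `w`: its blocks, the one applied first at the head. -/
structure Transformer (d w : ℕ) where
  blocks : List (TransformerBlock d w)

/-- The number of blocks. -/
def Transformer.numBlocks {d w : ℕ} (T : Transformer d w) : ℕ :=
  T.blocks.length

/-- The total number of parameters. -/
def Transformer.numParams {d w : ℕ} (T : Transformer d w) : ℕ :=
  (T.blocks.map TransformerBlock.numParams).sum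

/-- The map on sequences realized by the softmax transformer with temperature `τ`. -/
def Transformer.softmaxMap {d w : ℕ} (T : Transformer d w) (τ : ℝ) (X : TokenSeq d) :
    TokenSeq d :=
  T.blocks.foldl (fun Z B => B.apply τ Z) X

end

/-!
The result holds at every temperature and with width `1`, since a scalar matrix `A = c I` can absorb
the temperature into `c`.

The first block sends all sequences to one line `ℝ e` so that different sequences occupy disjoint
intervals. Its feed-forward layer takes a generic linear coordinate `t`, injective on all tokens,
and shifts it by a large `K`. Its attention layer then returns, up to a small residual term, the mean
of the sequence with weights proportional to `exp (s (1 + tᵢ / K) tₗ)`, which as `K → ∞` tends to the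
mean with weights `exp (s tₗ)` for every query `i`. That mean is the logarithmic derivative in `s`
of an exponential sum. Since exponentials are linearly independent, it determines the set of
coordinates (`range_eq_of_softMean_eq`), and by analyticity one `s` separates finitely many sets
(`exists_softMean_injective`). The residual term keeps the tokens of a sequence distinct
(`exists_separating_attention`).

All later blocks attend trivially, so they form a feed-forward network that has to carry finitely
many intervals of the line to prescribed points. In `exists_layers_of_line`, two single-neuron layers
per target collapse the lowest remaining cluster of tokens to a point and then throw it to its
target, translated far out in the direction `e`, where later layers are inactive. A last layer undoes
the translation, and identity blocks fill up the number of blocks.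
-/

open Filter Topology

/-! ### Soft means of finite families of reals -/

section SoftMean

/-- The mean of the reals `t i` under the weights proportional to `exp (s * t i)`. -/
noncomputable def softMean {ι : Type*} [Fintype ι] (t : ι → ℝ) (s : ℝ) : ℝ :=
  (∑ i, Real.exp (s * t i) * t i) / ∑ i, Real.exp (s * t i)

lemma sum_exp_pos {ι : Type*} [Fintype ι] [Nonempty ι] (t : ι → ℝ) (s : ℝ) :
    0 < ∑ i, Real.exp (s * t i) :=
  Finset.sum_pos (fun _ _ => Real.exp_pos _) Finset.univ_nonempty

lemma hasDerivAt_sum_exp {ι : Type*} [Fintype ι] (t : ι → ℝ) (s : ℝ) :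
    HasDerivAt (fun s => ∑ i, Real.exp (s * t i)) (∑ i, Real.exp (s * t i) * t i) s :=
  HasDerivAt.fun_sum fun i _ => (hasDerivAt_mul_const (t i)).exp

lemma softMean_const_add {ι : Type*} [Fintype ι] [Nonempty ι] (t : ι → ℝ) (K s : ℝ) :
    softMean (fun i => K + t i) s = K + softMean t s := by
  have h := (sum_exp_pos t s).ne'
  have hK := (Real.exp_pos (s * K)).ne'
  have h1 : ∑ i, Real.exp (s * (K + t i)) = Real.exp (s * K) * ∑ i, Real.exp (s * t i) := by
    simp only [mul_add, Real.exp_add, Finset.mul_sum]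
  have h2 : ∑ i, Real.exp (s * (K + t i)) * (K + t i) =
      Real.exp (s * K) * (K * ∑ i, Real.exp (s * t i) + ∑ i, Real.exp (s * t i) * t i) := by
    simp only [mul_add, Real.exp_add, Finset.mul_sum, ← Finset.sum_add_distrib]
    exact Finset.sum_congr rfl fun _ _ => by ring
  unfold softMean
  rw [h1, h2]
  field_simp

lemma analyticAt_softMean {ι : Type*} [Fintype ι] [Nonempty ι] (t : ι → ℝ) (s : ℝ) :
    AnalyticAt ℝ (softMean t) s := by
  unfold softMean
  refine AnalyticAt.div ?_ ?_ (sum_exp_pos t s).ne'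
  · exact Finset.analyticAt_fun_sum _ fun i _ => by fun_prop
  · exact Finset.analyticAt_fun_sum _ fun i _ => by fun_prop

lemma linearIndependent_exp_mul :
    LinearIndependent ℝ (fun a : ℝ => fun s : ℝ => Real.exp (s * a)) := by
  let χ : ℝ → (Multiplicative ℝ →* ℝ) := fun a =>
    { toFun := fun s => Real.exp (s.toAdd * a)
      map_one' := by simp
      map_mul' := fun x y => by simp [add_mul, Real.exp_add] }
  have hχ : Function.Injective χ := fun a b h => by
    have := DFunLike.congr_fun h (Multiplicative.ofAdd 1)
    simpa [χ] using this
  exact (linearIndependent_monoidHom (Multiplicative ℝ) ℝ).comp χ hχ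

/-- A finite set of reals is determined, up to a scalar factor, by its exponential sum. -/
lemma finset_eq_of_sum_exp_eq {S T : Finset ℝ} (hS : S.Nonempty) {c : ℝ}
    (h : ∀ s : ℝ, ∑ a ∈ S, Real.exp (s * a) = c * ∑ b ∈ T, Real.exp (s * b)) : S = T := by
  have key := linearIndependent_iff'.1 linearIndependent_exp_mul (S ∪ T)
    (fun a => (if a ∈ S then 1 else 0) - c * (if a ∈ T then 1 else 0)) (by
      funext s
      have h1 : ∀ R ⊆ S ∪ T, ∑ a ∈ S ∪ T, (if a ∈ R then 1 else 0) * Real.exp (s * a)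
          = ∑ a ∈ R, Real.exp (s * a) := fun R hR => by
        simp [Finset.sum_ite_mem, Finset.inter_eq_right.2 hR]
      simp only [Finset.sum_apply, Pi.smul_apply, smul_eq_mul, Pi.zero_apply, sub_mul, mul_assoc,
        Finset.sum_sub_distrib, ← Finset.mul_sum]
      rw [h1 S Finset.subset_union_left, h1 T Finset.subset_union_right, h s, sub_self])
  have hc : ∀ a ∈ S, a ∈ T ∧ c = 1 := fun a ha => by
    have := key a (Finset.mem_union_left _ ha)
    by_cases haT : a ∈ T
    · simp only [ha, haT, if_true] at this
      exact ⟨haT, by linarith⟩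
    · simp [ha, haT] at this
  obtain ⟨a₀, ha₀⟩ := hS
  have hc1 := (hc a₀ ha₀).2
  refine Finset.Subset.antisymm (fun a ha => (hc a ha).1) fun b hb => ?_
  by_contra hbS
  have := key b (Finset.mem_union_right _ hb)
  simp [hb, hbS, hc1] at this

/-- The soft mean is the logarithmic derivative of the exponential sum, so as a function of the
weight exponent it determines the set of values. -/
lemma range_eq_of_softMean_eq {ι κ : Type*} [Fintype ι] [Nonempty ι] [Fintype κ] [Nonempty κ]
    {t : ι → ℝ} {t' : κ → ℝ} (ht : Function.Injective t) (ht' : Function.Injective t')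
    (h : softMean t = softMean t') : Set.range t = Set.range t' := by
  have hq : ∀ s, HasDerivAt
      (fun s => (∑ i, Real.exp (s * t i)) / ∑ k, Real.exp (s * t' k)) 0 s := fun s => by
    have hdiv := (hasDerivAt_sum_exp t s).fun_div (hasDerivAt_sum_exp t' s)
      (sum_exp_pos t' s).ne'
    have h1 := (sum_exp_pos t s).ne'
    have h2 := (sum_exp_pos t' s).ne'
    have h3 := congrFun h s
    unfold softMean at h3
    rw [div_eq_div_iff h1 h2] at h3
    rwa [h3, mul_comm (∑ i, Real.exp (s * t i)), sub_self, zero_div] at hdiv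
  have hconst := fun s => is_const_of_deriv_eq_zero (fun s => (hq s).differentiableAt)
    (fun s => (hq s).deriv) s 0
  classical
  have := finset_eq_of_sum_exp_eq (S := Finset.univ.image t) (T := Finset.univ.image t')
    (Finset.univ_nonempty.image t)
    (c := (∑ i, Real.exp (0 * t i)) / ∑ k, Real.exp (0 * t' k)) (fun s => by
      rw [Finset.sum_image ht.injOn, Finset.sum_image ht'.injOn]
      rw [← hconst s, div_mul_cancel₀ _ (sum_exp_pos t' s).ne'])
  have := congrArg (fun S : Finset ℝ => (S : Set ℝ)) this
  simpa using this

/-- Finitely many different sets of reals have pairwise different soft means at a common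
exponent: the differences of two soft means are analytic and not identically zero. -/
lemma exists_softMean_injective {J : Type*} [Finite J] {ι : J → Type*} [∀ j, Fintype (ι j)]
    [∀ j, Nonempty (ι j)] (t : ∀ j, ι j → ℝ) (ht : ∀ j, Function.Injective (t j))
    (hne : ∀ j j', j ≠ j' → Set.range (t j) ≠ Set.range (t j')) :
    ∃ s : ℝ, Function.Injective fun j => softMean (t j) s := by
  have hev : ∀ j j', j ≠ j' → ∀ᶠ s in 𝓝[≠] (0 : ℝ), softMean (t j) s ≠ softMean (t j') s := by
    intro j j' hjj
    rcases (analyticAt_softMean (t j) 0).eventually_eq_or_eventually_ne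
      (analyticAt_softMean (t j') 0) with h | h
    · refine absurd (range_eq_of_softMean_eq (ht j) (ht j') ?_) (hne j j' hjj)
      exact AnalyticOnNhd.eq_of_eventuallyEq (fun s _ => analyticAt_softMean (t j) s)
        (fun s _ => analyticAt_softMean (t j') s) h
    · exact h
  have hall : ∀ᶠ s in 𝓝[≠] (0 : ℝ), ∀ j j', j ≠ j' → softMean (t j) s ≠ softMean (t j') s := by
    simp only [eventually_all]
    exact hev
  obtain ⟨s, hs⟩ := hall.exists
  exact ⟨s, fun j j' h => by_contra fun hjj => hs j j' hjj h⟩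

/-- After a shift by a large `K`, attention with exponent `s / K` sees each token of a sequence
with almost the same query, so every output is close to the soft mean of the sequence at `s`. A
small residual `ρ` keeps the tokens of one sequence apart. -/
lemma exists_separating_attention {J : Type*} [Finite J] {ι : J → Type*} [∀ j, Fintype (ι j)]
    [∀ j, Nonempty (ι j)] (t : ∀ j, ι j → ℝ) (ht : ∀ j, Function.Injective (t j)) (s : ℝ) :
    ∃ K β ρ : ℝ, (∀ j i, 0 < K + t j i) ∧
      (∀ j, Function.Injective fun i =>
        ρ * (K + t j i) + softMean (fun l => K + t j l) (β * (K + t j i))) ∧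
      ∀ j j', softMean (t j) s < softMean (t j') s → ∀ i i',
        ρ * (K + t j i) + softMean (fun l => K + t j l) (β * (K + t j i)) <
        ρ * (K + t j' i') + softMean (fun l => K + t j' l) (β * (K + t j' i')) := by
  have hlim : ∀ j i, Tendsto (fun K : ℝ => softMean (t j) (s / K * (K + t j i))) atTop
      (𝓝 (softMean (t j) s)) := by
    intro j i
    refine (analyticAt_softMean (t j) s).continuousAt.tendsto.comp ?_
    have h : Tendsto (fun K : ℝ => s + s * t j i * K⁻¹) atTop (𝓝 (s + s * t j i * 0)) :=
      tendsto_const_nhds.add (tendsto_const_nhds.mul tendsto_inv_atTop_zero)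
    rw [mul_zero, add_zero] at h
    refine h.congr' ?_
    filter_upwards [eventually_ne_atTop 0] with K hK
    field_simp
  have hK1 : ∀ᶠ K : ℝ in atTop, ∀ j i, 0 < K + t j i := by
    simp only [eventually_all]
    intro j i
    filter_upwards [eventually_gt_atTop (-t j i)] with K hK
    linarith
  have hK2 : ∀ᶠ K : ℝ in atTop, ∀ j j', softMean (t j) s < softMean (t j') s → ∀ i i',
      softMean (t j) (s / K * (K + t j i)) < softMean (t j') (s / K * (K + t j' i')) := by
    simp only [eventually_all]
    intro j j' h i i'
    exact (hlim j i).eventually_lt (hlim j' i') h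
  obtain ⟨K, hKpos, hK⟩ := (hK1.and hK2).exists
  have hcont : ∀ j i, Tendsto
      (fun ρ : ℝ => ρ * (K + t j i) + (K + softMean (t j) (s / K * (K + t j i)))) (𝓝[>] 0)
      (𝓝 (K + softMean (t j) (s / K * (K + t j i)))) := by
    intro j i
    refine Tendsto.mono_left ?_ nhdsWithin_le_nhds
    refine Continuous.tendsto' (by fun_prop) _ _ (by simp)
  have hρ1 : ∀ᶠ ρ : ℝ in 𝓝[>] 0, ∀ j i i', i ≠ i' →
      ρ * (K + t j i) + (K + softMean (t j) (s / K * (K + t j i))) ≠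
      ρ * (K + t j i') + (K + softMean (t j) (s / K * (K + t j i'))) := by
    simp only [eventually_all]
    intro j i i' hii
    by_cases heq : softMean (t j) (s / K * (K + t j i)) = softMean (t j) (s / K * (K + t j i'))
    · filter_upwards [self_mem_nhdsWithin] with ρ hρ h
      rw [heq, add_left_inj] at h
      exact hii (ht j (add_left_cancel (mul_left_cancel₀ (ne_of_gt hρ) h)))
    · have h := ((hcont j i).sub (hcont j i')).eventually_ne (b₂ := 0) (by
        simpa [sub_eq_zero] using heq)
      exact h.mono fun ρ hρ => sub_ne_zero.1 hρ
  have hρ2 : ∀ᶠ ρ : ℝ in 𝓝[>] 0, ∀ j j', softMean (t j) s < softMean (t j') s → ∀ i i',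
      ρ * (K + t j i) + (K + softMean (t j) (s / K * (K + t j i))) <
      ρ * (K + t j' i') + (K + softMean (t j') (s / K * (K + t j' i'))) := by
    simp only [eventually_all]
    intro j j' h i i'
    exact (hcont j i).eventually_lt (hcont j' i') (by simpa using hK j j' h i i')
  obtain ⟨ρ, h1, h2⟩ := (hρ1.and hρ2).exists
  refine ⟨K, s / K, ρ, hKpos, ?_, ?_⟩
  · intro j i i' h
    simp only [softMean_const_add] at h
    by_contra hii
    exact h1 j i i' hii h
  · simpa only [softMean_const_add] using h2

end SoftMean

/-! ### Single-neuron layers and attention on a line -/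

section Layers

variable {d : ℕ}

/-- Application of `f` to every token. -/
def TokenSeq.map (f : Token d → Token d) (X : TokenSeq d) : TokenSeq d where
  len := X.len
  len_pos := X.len_pos
  tok := fun i => f (X.tok i)

/-- The feed-forward layer `x ↦ η x + max 0 (⟨u, x⟩ + b) w` with a single neuron. -/
def neuron (η : ℝ) (w u : Token d) (b : ℝ) : FeedForward d 1 where
  η := η
  W := Matrix.of fun i _ => w i
  U := Matrix.of fun _ i => u i
  b := fun _ => b

lemma neuron_onToken (η : ℝ) (w u : Token d) (b : ℝ) (x : Token d) :
    (neuron η w u b).onToken x = η • x + max 0 (inner ℝ u x + b) • w := by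
  ext i
  simp [neuron, FeedForward.onToken, Matrix.mulVec, dotProduct, PiLp.inner_apply, mul_comm]

lemma neuron_onToken_eq_self {e x : Token d} {θ : ℝ} (w : Token d) (h : θ ≤ inner ℝ e x) :
    (neuron 1 w (-e) θ).onToken x = x := by
  rw [neuron_onToken, inner_neg_left, max_eq_left (by linarith)]
  simp

lemma neuron_onToken_smul {e : Token d} (he : ‖e‖ = 1) (w : Token d) {θ a : ℝ} (h : a ≤ θ) :
    (neuron 1 w (-e) θ).onToken (a • e) = a • e + (θ - a) • w := by
  rw [neuron_onToken, inner_neg_left, inner_smul_right, real_inner_self_eq_norm_sq, he,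
    max_eq_right (by linarith), one_smul]
  congr 2
  ring

/-- The block that applies a feed-forward layer and then attends trivially. -/
def FeedForward.toBlock {w : ℕ} (F : FeedForward d w) : TransformerBlock d w where
  ff := F
  sa := ⟨1, .scalar 0, .scalar 0⟩

lemma FeedForward.toBlock_apply {w : ℕ} (F : FeedForward d w) (τ : ℝ) (X : TokenSeq d) :
    F.toBlock.apply τ X = X.map F.onToken := by
  simp [TransformerBlock.apply, FeedForward.toBlock, SelfAttention.apply, FeedForward.apply,
    TokenSeq.map, AttentionMatrix.toMatrix, matToken]

/-- The action of a list of feed-forward layers, applied from the head on, on one token. -/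
def runLayers {w : ℕ} (L : List (FeedForward d w)) (x : Token d) : Token d :=
  L.foldl (fun y F => F.onToken y) x

lemma foldl_toBlock {w : ℕ} (L : List (FeedForward d w)) (τ : ℝ) (X : TokenSeq d) :
    (L.map FeedForward.toBlock).foldl (fun Z B => B.apply τ Z) X = X.map (runLayers L) := by
  induction L generalizing X with
  | nil => rfl
  | cons F L ih =>
    rw [List.map_cons, List.foldl_cons, ih, FeedForward.toBlock_apply]
    rfl

/-- On tokens that lie on a line, attention with scalar matrices acts through soft means. -/
lemma attention_on_line {e : Token d} (he : ‖e‖ = 1) {τ : ℝ} (hτ : 0 < τ) (ρ β : ℝ)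
    (X : TokenSeq d) (a : Fin X.len → ℝ) (ha : ∀ i, X.tok i = a i • e) (i : Fin X.len) :
    ((⟨ρ, .scalar 1, .scalar (τ * β)⟩ : SelfAttention d).apply τ X).tok i =
      (ρ * a i + softMean a (β * a i)) • e := by
  have hin : ∀ k l, 1 / τ * inner ℝ (matToken
      (AttentionMatrix.scalar (τ * β) : AttentionMatrix d).toMatrix (X.tok k)) (X.tok l) =
      β * a k * a l := by
    intro k l
    have : matToken (AttentionMatrix.scalar (τ * β) : AttentionMatrix d).toMatrix (X.tok k) =
        (τ * β * a k) • e := by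
      rw [ha k]
      ext m
      simp [matToken, AttentionMatrix.toMatrix, Matrix.smul_mulVec, mul_assoc]
    rw [this, ha l, inner_smul_left, inner_smul_right, real_inner_self_eq_norm_sq, he]
    simp only [conj_trivial]
    field_simp
  have hV : ∀ x : Token d, matToken (AttentionMatrix.scalar 1 : AttentionMatrix d).toMatrix x = x :=
    fun x => by simp [matToken, AttentionMatrix.toMatrix]
  simp only [SelfAttention.apply, hV, softmaxWeight, hin]
  simp only [ha, smul_smul, ← Finset.sum_smul, ← add_smul]
  congr 2
  unfold softMean
  rw [Finset.sum_div]
  exact Finset.sum_congr rfl fun _ _ => by ring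

/-- Each `q` in `Q`, in increasing order, costs two layers: the first replaces the coordinate `p`
by `max p q`, which collapses everything up to `q` to `q • e`, and the second carries `q • e` to
`z q` and is inactive on the coordinates of `P` above `q`. The points `z q` lie so far out in
the direction `e` that no later layer moves them. -/
lemma exists_layers_of_line {e : Token d} (he : ‖e‖ = 1) (P Q : Finset ℝ) (z : ℝ → Token d)
    {H : ℝ} (hQ : ∀ q ∈ Q, q < H) (hz : ∀ q ∈ Q, H ≤ inner ℝ e (z q)) :
    ∃ L : List (FeedForward d 1), L.length = 2 * Q.card ∧
      (∀ x, H ≤ inner ℝ e x → runLayers L x = x) ∧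
      ∀ p ∈ P, ∀ q ∈ Q, p ≤ q → (∀ q' ∈ Q, p ≤ q' → q ≤ q') → runLayers L (p • e) = z q := by
  have hin : ∀ a : ℝ, inner ℝ e (a • e) = a := fun a => by
    rw [inner_smul_right, real_inner_self_eq_norm_sq, he]; ring
  induction Q using Finset.induction_on_min with
  | empty => exact ⟨[], by simp, fun x _ => rfl, by simp⟩
  | insert a s has ih =>
    obtain ⟨L, hlen, hfix, hrun⟩ := ih (fun q hq => hQ q (Finset.mem_insert_of_mem hq))
      (fun q hq => hz q (Finset.mem_insert_of_mem hq))
    have haH : a < H := hQ a (Finset.mem_insert_self a s)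
    -- a level just above `a`, below every coordinate of `P` that exceeds `a`
    obtain ⟨θ, haθ, hθH, hθP⟩ : ∃ θ, a < θ ∧ θ ≤ H ∧ ∀ p ∈ P, a < p → θ ≤ p := by
      have hne : (insert H (P.filter (a < ·))).Nonempty := Finset.insert_nonempty _ _
      refine ⟨(insert H (P.filter (a < ·))).min' hne, ?_, ?_, ?_⟩
      · rw [Finset.lt_min'_iff]
        simp [haH]
      · exact Finset.min'_le _ _ (by simp)
      · exact fun p hp hap => Finset.min'_le _ _ (by simp [hp, hap])
    refine ⟨neuron 1 e (-e) a :: neuron 1 ((θ - a)⁻¹ • (z a - a • e)) (-e) θ :: L, ?_, ?_, ?_⟩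
    · rw [Finset.card_insert_of_notMem fun h => lt_irrefl _ (has a h)]
      simp only [List.length_cons, hlen]
      ring
    · intro x hx
      simp only [runLayers, List.foldl_cons]
      rw [neuron_onToken_eq_self (θ := a) _ (by linarith), neuron_onToken_eq_self _ (by linarith)]
      exact hfix x hx
    · intro p hp q hq hpq hmin
      simp only [runLayers, List.foldl_cons]
      rcases le_or_gt p a with hpa | hpa
      · obtain rfl : q = a := by
          refine le_antisymm (hmin a (Finset.mem_insert_self a s) hpa) ?_
          rcases Finset.mem_insert.1 hq with h | h
          exacts [h.ge, (has q h).le]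
        rw [neuron_onToken_smul he _ hpa, ← add_smul, add_sub_cancel,
          neuron_onToken_smul he _ haθ.le, smul_inv_smul₀ (sub_pos.2 haθ).ne', add_sub_cancel]
        exact hfix _ (hz q hq)
      · have hqs : q ∈ s := (Finset.mem_insert.1 hq).resolve_left fun h => by linarith
        rw [neuron_onToken_eq_self (θ := a) _ (by rw [hin]; exact hpa.le),
          neuron_onToken_eq_self _ (by rw [hin]; exact hθP p hp hpa)]
        exact hrun p hp q hqs hpq fun q' hq' => hmin q' (Finset.mem_insert_of_mem hq')

end Layers

/-! ### Carrying intervals of a line to prescribed sets of points -/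

/-- Real families `r j` occupying disjoint intervals are carried to the sets of points `Y j` by
feed-forward layers. Among the values of `r j` choose as many representatives as `Y j` has
points, the largest value among them; then the least representative above a value of `r j` belongs
to `r j`. -/
lemma exists_layers_of_separated {d N : ℕ} {e : Token d} (he : ‖e‖ = 1) (Y : Fin N → TokenSeq d)
    (n : Fin N → ℕ) (hn : ∀ j, (Y j).len ≤ n j) (r : ∀ j, Fin (n j) → ℝ)
    (hr : ∀ j, Function.Injective (r j))
    (hsep : ∀ j j', j ≠ j' → (∀ i i', r j i < r j' i') ∨ ∀ i i', r j' i' < r j i) :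
    ∃ L : List (FeedForward d 1), L.length = 2 * ∑ j, (Y j).len + 1 ∧
      ∀ j, Set.range (fun i => runLayers L (r j i • e)) = Set.range (Y j).tok := by
  classical
  have hpos : ∀ j, 0 < n j := fun j => (Y j).len_pos.trans_le (hn j)
  have hmax : ∀ j, ∃ i, ∀ i', r j i' ≤ r j i := fun j => by
    have : Nonempty (Fin (n j)) := ⟨⟨0, hpos j⟩⟩
    exact Finite.exists_max (r j)
  choose top htop using hmax
  let rep : ∀ j, Fin (Y j).len → Fin (n j) := fun j k =>
    Equiv.swap (⟨0, hpos j⟩ : Fin (n j)) (top j) (Fin.castLE (hn j) k)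
  have hrep : ∀ j, Function.Injective (rep j) := fun j =>
    (Equiv.injective _).comp (Fin.castLE_injective (hn j))
  have hreptop : ∀ j, rep j ⟨0, (Y j).len_pos⟩ = top j := fun j =>
    Equiv.swap_apply_left _ _
  let q : (Σ j, Fin (Y j).len) → ℝ := fun jk => r jk.1 (rep jk.1 jk.2)
  have hq : Function.Injective q := by
    rintro ⟨j, k⟩ ⟨j', k'⟩ h
    obtain rfl : j = j' := by
      by_contra hjj
      rcases hsep j j' hjj with h' | h'
      exacts [(h' _ _).ne h, (h' _ _).ne' h]
    exact congrArg (Sigma.mk j) (hrep j (hr j h))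
  let P : Finset ℝ := Finset.univ.image fun ji : Σ j, Fin (n j) => r ji.1 ji.2
  let Q : Finset ℝ := Finset.univ.image q
  obtain ⟨H, hH⟩ := P.bddAbove
  have hrP : ∀ j i, r j i ∈ P := fun j i => Finset.mem_image_of_mem
    (fun ji : Σ j, Fin (n j) => r ji.1 ji.2) (Finset.mem_univ (⟨j, i⟩ : Σ j, Fin (n j)))
  have hQP : Q ⊆ P := by
    intro p hp
    obtain ⟨⟨j, k⟩, -, rfl⟩ := Finset.mem_image.1 hp
    exact hrP _ _
  let y : (Σ j, Fin (Y j).len) → Token d := fun jk => (Y jk.1).tok jk.2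
  -- a lower bound for the coordinates of the targets along `e`; all targets are moved by `B • e`
  obtain ⟨G, hG⟩ := (Finset.univ.image fun jk => inner ℝ e (y jk)).bddBelow
  let B : ℝ := H + 1 - G
  let z : ℝ → Token d := Function.extend q (fun jk => y jk + B • e) 0
  have hzq : ∀ jk, z (q jk) = y jk + B • e := fun jk => hq.extend_apply _ _ _
  obtain ⟨L, hlen, -, hrun⟩ := exists_layers_of_line he P Q z (H := H + 1)
    (fun p hp => (hH (hQP hp)).trans_lt (lt_add_one H)) (by
      intro p hp
      obtain ⟨jk, -, rfl⟩ := Finset.mem_image.1 hp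
      have : G ≤ inner ℝ e (y jk) := hG (by simp)
      rw [hzq, inner_add_right, inner_smul_right, real_inner_self_eq_norm_sq, he]
      simp only [B]
      linarith)
  have hlast : ∀ x : Token d, runLayers (L ++ [neuron 1 (-(B • e)) 0 1]) x =
      runLayers L x - B • e := fun x => by
    simp [runLayers, List.foldl_append, neuron_onToken, sub_eq_add_neg]
  refine ⟨L ++ [neuron 1 (-(B • e)) 0 1], ?_, ?_⟩
  · rw [List.length_append, hlen, Finset.card_image_of_injective _ hq]
    simp
  · intro j
    ext x
    simp only [Set.mem_range, hlast]
    constructor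
    · rintro ⟨i, rfl⟩
      have htopQ : r j (top j) ∈ Q := by
        rw [← hreptop j]
        exact Finset.mem_image_of_mem q
          (Finset.mem_univ (⟨j, ⟨0, (Y j).len_pos⟩⟩ : Σ j, Fin (Y j).len))
      obtain ⟨p, hp, hpmin⟩ := Finset.exists_min_image (Q.filter (r j i ≤ ·)) id
        ⟨_, Finset.mem_filter.2 ⟨htopQ, htop j i⟩⟩
      simp only [Finset.mem_filter, id, and_imp] at hp hpmin
      rw [hrun _ (hrP j i) p hp.1 hp.2 hpmin]
      obtain ⟨⟨j', k⟩, -, rfl⟩ := Finset.mem_image.1 hp.1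
      obtain rfl : j' = j := by
        by_contra hjj
        have h1 : r j i ≤ r j' (rep j' k) := hp.2
        have h2 : r j' (rep j' k) ≤ r j (top j) := hpmin _ htopQ (htop j i)
        rcases hsep j' j hjj with h' | h'
        · exact absurd (h' (rep j' k) i) h1.not_gt
        · exact absurd (h' (rep j' k) (top j)) h2.not_gt
      exact ⟨k, by rw [hzq]; simp [y]⟩
    · rintro ⟨k, rfl⟩
      refine ⟨rep j k, ?_⟩
      have hkQ : q ⟨j, k⟩ ∈ Q := Finset.mem_image_of_mem q (Finset.mem_univ _)
      have := hrun (r j (rep j k)) (hrP j _) (q ⟨j, k⟩) hkQ le_rfl fun _ _ h => h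
      rw [this, hzq]
      simp [y]

/-! ### Separating the sequences -/

/-- Finitely many points are told apart by a generic linear coordinate. -/
lemma exists_inner_injOn {d : ℕ} {S : Set (Token d)} (hS : S.Finite) :
    ∃ u : Token d, Set.InjOn (fun x => inner ℝ u x) S := by
  classical
  have := hS.to_subtype
  obtain ⟨f, hf⟩ := Module.exists_dual_forall_apply_ne_zero (K := ℝ)
    (fun xy : {xy : S × S // xy.1 ≠ xy.2} => (xy.1.1.1 : Token d) - xy.1.2.1)
    (fun xy h => xy.2 (Subtype.ext (sub_eq_zero.1 h)))
  refine ⟨(InnerProductSpace.toDual ℝ (Token d)).symm (LinearMap.toContinuousLinearMap f), ?_⟩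
  intro x hx y hy h
  by_contra hxy
  refine hf ⟨(⟨x, hx⟩, ⟨y, hy⟩), fun h' => hxy (congrArg Subtype.val h')⟩ ?_
  simpa [sub_eq_zero] using h

lemma toBlock_numParams {d : ℕ} (F : FeedForward d 1) : F.toBlock.numParams = 2 * d + 5 := by
  simp [TransformerBlock.numParams, FeedForward.numParams, SelfAttention.numParams,
    FeedForward.toBlock, AttentionMatrix.numParams]
  ring

/-- One block carries the sequences to disjoint intervals of a line. -/
lemma exists_separating_block {d N : ℕ} {e : Token d} (he : ‖e‖ = 1) (X : Fin N → TokenSeq d)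
    (hne : ∀ j j', j ≠ j' → ¬ (X j).SameSet (X j')) (hX : ∀ j, (X j).PairwiseDistinct)
    {τ : ℝ} (hτ : 0 < τ) :
    ∃ B : TransformerBlock d 1, B.numParams = 2 * d + 5 ∧
      ∃ r : ∀ j, Fin (X j).len → ℝ, (∀ j, Function.Injective (r j)) ∧
        (∀ j j', j ≠ j' → (∀ i i', r j i < r j' i') ∨ ∀ i i', r j' i' < r j i) ∧
        ∀ j, B.apply τ (X j) = ⟨(X j).len, (X j).len_pos, fun i => r j i • e⟩ := by
  have : ∀ j, Nonempty (Fin (X j).len) := fun j => ⟨⟨0, (X j).len_pos⟩⟩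
  obtain ⟨u, hu⟩ := exists_inner_injOn (Set.finite_iUnion fun j => Set.finite_range (X j).tok)
  have hmem : ∀ j i, (X j).tok i ∈ ⋃ j, Set.range (X j).tok := fun j i =>
    Set.mem_iUnion.2 ⟨j, i, rfl⟩
  let t : ∀ j, Fin (X j).len → ℝ := fun j i => inner ℝ u ((X j).tok i)
  have ht : ∀ j, Function.Injective (t j) := fun j i i' h =>
    hX j (hu (hmem j i) (hmem j i') h)
  have htne : ∀ j j', j ≠ j' → Set.range (t j) ≠ Set.range (t j') := by
    intro j j' hjj h
    refine hne j j' hjj ?_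
    have himg : ∀ j, Set.range (t j) = (fun x => inner ℝ u x) '' Set.range (X j).tok := fun j =>
      Set.range_comp (fun x => inner ℝ u x) (X j).tok
    rw [himg, himg] at h
    have := hu.image_eq_image_iff (Set.subset_iUnion (fun j => Set.range (X j).tok) j)
      (Set.subset_iUnion (fun j => Set.range (X j).tok) j') |>.1 h
    unfold TokenSeq.SameSet TokenSeq.hausdorffDist
    rw [this, Metric.hausdorffDist_self_zero]
  obtain ⟨s, hs⟩ := exists_softMean_injective t ht htne
  obtain ⟨K, β, ρ, hpos, hinj, hsep⟩ := exists_separating_attention t ht s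
  refine ⟨⟨neuron 0 e u K, ⟨ρ, .scalar 1, .scalar (τ * β)⟩⟩, toBlock_numParams (neuron 0 e u K),
    _, hinj, ?_, ?_⟩
  · intro j j' hjj
    rcases lt_or_gt_of_ne fun h => hjj (hs h) with h | h
    · exact Or.inl (hsep j j' h)
    · exact Or.inr fun i i' => hsep j' j h i' i
  · intro j
    unfold TransformerBlock.apply
    have := attention_on_line he hτ ρ β ((neuron 0 e u K).apply (X j)) (fun i => K + t j i)
      (fun i => by
        have h := hpos j i
        simp only [FeedForward.apply, neuron_onToken, zero_smul, zero_add]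
        rw [add_comm (inner ℝ u _), max_eq_right h.le])
    exact congrArg (TokenSeq.mk (X j).len (X j).len_pos) (funext this)

/-! ### Assembling the transformer -/

theorem theorem2 :
    ∃ C : ℕ, ∀ (N d : ℕ), 2 ≤ d → ∀ (X Y : Fin N → TokenSeq d),
      (∀ j, (Y j).len ≤ (X j).len) →
      (∀ j j', j ≠ j' → ¬ (X j).SameSet (X j')) →
      (∀ j, (X j).PairwiseDistinct) →
      (∀ j, (Y j).PairwiseDistinct) →
      ∃ τ₀ : ℝ, 0 < τ₀ ∧ ∀ τ : ℝ, 0 < τ → τ < τ₀ →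
        ∃ w : ℕ, 1 ≤ w ∧ w ≤ 4 ∧ ∃ T : Transformer d w,
          T.numBlocks = 2 * ∑ j, (Y j).len + 3 * N ∧
          T.numParams ≤ C * (d * ∑ j, (Y j).len) ∧
          ∀ j, (T.softmaxMap τ (X j)).SameSet (Y j) := by
  -- each block has `2 * d + 5 ≤ 5 * d` parameters, and there are at most `5 * ∑ j, (Y j).len` blocks
  refine ⟨25, fun N d hd X Y hlen hne hX _ =>
    ⟨1, one_pos, fun τ hτ _ => ⟨1, le_rfl, by norm_num, ?_⟩⟩⟩
  rcases Nat.eq_zero_or_pos N with rfl | hN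
  · exact ⟨⟨[]⟩, by simp [Transformer.numBlocks], by simp [Transformer.numParams],
      fun j => j.elim0⟩
  let e : Token d := EuclideanSpace.single ⟨0, by omega⟩ 1
  have he : ‖e‖ = 1 := by simp [e]
  obtain ⟨B, hB, r, hr, hsep, hBapply⟩ := exists_separating_block he X hne hX hτ
  obtain ⟨L, hL, hrange⟩ := exists_layers_of_separated he Y _ hlen r hr hsep
  let pad : List (FeedForward d 1) := List.replicate (3 * N - 2) (neuron 1 0 0 0)
  have hpad : ∀ (k : ℕ) (x : Token d), runLayers (List.replicate k (neuron 1 0 0 0)) x = x := by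
    intro k x
    induction k with
    | zero => rfl
    | succ k ih =>
      rw [List.replicate_succ]
      simpa [runLayers, neuron_onToken] using ih
  have hnum : (B :: (L ++ pad).map FeedForward.toBlock).length = 2 * ∑ j, (Y j).len + 3 * N := by
    simp only [List.length_cons, List.length_map, List.length_append, hL, pad,
      List.length_replicate]
    omega
  have hNM : N ≤ ∑ j, (Y j).len := by
    simpa using Finset.card_nsmul_le_sum Finset.univ (fun j => (Y j).len) 1 fun j _ => (Y j).len_pos
  refine ⟨⟨B :: (L ++ pad).map FeedForward.toBlock⟩, hnum, ?_, ?_⟩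
  · have hp : ∀ x ∈ (B :: (L ++ pad).map FeedForward.toBlock).map TransformerBlock.numParams,
        x ≤ 5 * d := by
      intro x hx
      have : x = 2 * d + 5 := by
        simp only [List.map_cons, List.map_map, List.mem_cons, List.mem_map,
          Function.comp_apply, toBlock_numParams, hB] at hx
        rcases hx with h | ⟨_, _, h⟩
        exacts [h, h.symm]
      omega
    refine (List.sum_le_card_nsmul _ _ hp).trans ?_
    rw [List.length_map, hnum, smul_eq_mul]
    calc (2 * ∑ j, (Y j).len + 3 * N) * (5 * d)
        ≤ (5 * ∑ j, (Y j).len) * (5 * d) := Nat.mul_le_mul_right _ (by omega)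
      _ = 25 * (d * ∑ j, (Y j).len) := by ring
  · intro j
    have hrun : ∀ x, runLayers (L ++ pad) x = runLayers L x := fun x => by
      have := hpad (3 * N - 2) (runLayers L x)
      simpa only [runLayers, List.foldl_append, pad] using this
    unfold TokenSeq.SameSet TokenSeq.hausdorffDist Transformer.softmaxMap
    rw [List.foldl_cons, foldl_toBlock, hBapply]
    simp only [TokenSeq.map, hrun, hrange]
    exact Metric.hausdorffDist_self_zero
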